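/- A quantum query algorithm over $\mathbb{F}_p^n$ ($p$ prime) with oracle access to a matrix $M\in\mathbb{F}_p^{n\times n}$ and a vector $v\in\mathbb{F}_p^n$ starts in a fixed computational basis state $|0\rangle$ of a finite-dimensional space (query registers, an output register with basis $\mathbb{F}_p^n$, and a workspace) and applies a fixed finite sequence of steps. Each step is either a unitary independent of $(M,v)$ or a query, that is, a use of one of the oracles $U_M|j,k,z\rangle=|j,k,z+M_{jk}\rangle$, $U_v|j,z\rangle=|j,z+v_j\rangle$ or of their inverses. Its success probability on $(M,v)$ is $\Pr_{\mathsf{ALG}}[\mathsf{ALG}^{M,v}=Mv]=\|\Pi_{Mv}\,\mathsf{ALG}^{M,v}|0\rangle\|^2$, where $\Pi_{Mv}$ is the orthogonal projection onto the value $Mv$ of the output register. **Lemma.** There is an absolute constant $C>0$ such that the following holds. Let $p$ be a prime, let $n\ge 1$, let $k$ divide $n$, put $d=n/k$, and let $\alpha\in(0,1]$ satisfy $\alpha\ge 4\exp(-k/3200)$. Suppose that there is a quantum query algorithm $\mathsf{ALG}$ for $n\times n$ matrices and $n$-vectors over $\mathbb{F}_p$ that makes at most $Q$ queries to $U_M$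 and $U_M^\dagger$ (queries to $U_v$ and $U_v^\dagger$ are not charged) and satisfies $$\mathbb{E}_{M\in\mathbb{F}_p^{n\times n}}\,\mathbb{E}_{v\in\mathbb{F}_p^n}\left\|\Pi_{Mv}\,\mathsf{ALG}^{M,v}|0\rangle\right\|^2\ \ge\ \alpha .$$ Then there is a quantum query algorithm $\mathsf{ALG}_3$ for $d\times d$ matrices and $d$-vectors over $\mathbb{F}_p$ that makes in total (to the matrix oracle, the vector oracle and their inverses) at most $C\,\alpha^{-2}\,(Q+n^{3/2})$ queries and such that, for every $M\in\mathbb{F}_p^{d\times d}$, $$\Pr_{v\sim\mathbb{F}_p^d}\Big[\Pr_{\mathsf{ALG}_3}\big[\mathsf{ALG}_3^{M,v}=Mv\big]\ge 0.99\Big]\ \ge\ 0.99 .$$ -/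

import Mathlib

open scoped BigOperators

namespace QuantumMvM

/-- Labels of the computational basis: a matrix query register `|j, k, z⟩`, a vector query register
`|j, z⟩`, an output register holding a vector over `𝔽_p`, and a workspace of finite dimension `w`. -/
abbrev Basis (p n w : ℕ) : Type :=
  (Fin n × Fin n × ZMod p) × (Fin n × ZMod p) × (Fin n → ZMod p) × Fin w

/-- The finite-dimensional Hilbert space of the algorithm. -/
abbrev State (p n w : ℕ) [NeZero p] : Type := EuclideanSpace ℂ (Basis p n w)

variable {p n w : ℕ}

/-- The action `|j, k, z⟩ ↦ |j, k, z + M j k⟩` on basis labels; other registers are unchanged. -/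
def matrixPerm (M : Matrix (Fin n) (Fin n) (ZMod p)) : Equiv.Perm (Basis p n w) where
  toFun b := ((b.1.1, b.1.2.1, b.1.2.2 + M b.1.1 b.1.2.1), b.2)
  invFun b := ((b.1.1, b.1.2.1, b.1.2.2 - M b.1.1 b.1.2.1), b.2)
  left_inv b := by simp
  right_inv b := by simp

/-- The action `|j, z⟩ ↦ |j, z + v j⟩` on basis labels; other registers are unchanged. -/
def vectorPerm (v : Fin n → ZMod p) : Equiv.Perm (Basis p n w) where
  toFun b := (b.1, (b.2.1.1, b.2.1.2 + v b.2.1.1), b.2.2)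
  invFun b := (b.1, (b.2.1.1, b.2.1.2 - v b.2.1.1), b.2.2)
  left_inv b := by simp
  right_inv b := by simp

section

variable [NeZero p]

/-- The unitary that permutes the computational basis: `|b⟩ ↦ |e b⟩`. -/
noncomputable def permUnitary (e : Equiv.Perm (Basis p n w)) :
    State p n w ≃ₗᵢ[ℂ] State p n w :=
  LinearIsometryEquiv.piLpCongrLeft 2 ℂ ℂ e

/-- The oracle `U_M`. -/
noncomputable def matrixOracle (M : Matrix (Fin n) (Fin n) (ZMod p)) :
    State p n w ≃ₗᵢ[ℂ] State p n w :=
  permUnitary (matrixPerm M)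

/-- The oracle `U_v`. -/
noncomputable def vectorOracle (v : Fin n → ZMod p) :
    State p n w ≃ₗᵢ[ℂ] State p n w :=
  permUnitary (vectorPerm v)

/-- One step of a query algorithm: a unitary that does not depend on the input, or a query to
`U_M`, `U_M†`, `U_v` or `U_v†`. -/
inductive Step (p n w : ℕ) [NeZero p] : Type
  | unitary (U : State p n w ≃ₗᵢ[ℂ] State p n w) : Step p n w
  | matrixQuery : Step p n w
  | matrixQueryInv : Step p n w
  | vectorQuery : Step p n w
  | vectorQueryInv : Step p n w

/-- The unitary performed by a step on input `(M, v)`. -/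
noncomputable def Step.eval (M : Matrix (Fin n) (Fin n) (ZMod p)) (v : Fin n → ZMod p) :
    Step p n w → (State p n w ≃ₗᵢ[ℂ] State p n w)
  | .unitary U => U
  | .matrixQuery => matrixOracle M
  | .matrixQueryInv => (matrixOracle M).symm
  | .vectorQuery => vectorOracle v
  | .vectorQueryInv => (vectorOracle v).symm

/-- The number of uses of `U_M` and `U_M†` in a step. -/
def Step.matrixCost : Step p n w → ℕ
  | .matrixQuery => 1
  | .matrixQueryInv => 1
  | _ => 0

/-- The number of uses of `U_v` and `U_v†` in a step. -/
def Step.vectorCost : Step p n w → ℕ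
  | .vectorQuery => 1
  | .vectorQueryInv => 1
  | _ => 0

end

/-- A quantum query algorithm with oracle access to a matrix `M ∈ 𝔽_p^{n×n}` and a vector
`v ∈ 𝔽_p^n`. Neither the workspace, nor the initial basis state, nor the list of steps depends
on `(M, v)`. -/
structure QueryAlgorithm (p n : ℕ) [NeZero p] where
  /-- The dimension of the workspace. -/
  work : ℕ
  /-- The label of the fixed basis state in which the registers are initialized. -/
  init : Basis p n work
  /-- The steps, in the order in which they are performed. -/
  steps : List (Step p n work)

namespace QueryAlgorithm

variable [NeZero p] (A : QueryAlgorithm p n)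

/-- The number of queries to `U_M` and `U_M†`. -/
def matrixQueries : ℕ := (A.steps.map Step.matrixCost).sum

/-- The number of queries to `U_v` and `U_v†`. -/
def vectorQueries : ℕ := (A.steps.map Step.vectorCost).sum

/-- The final state of the algorithm on input `(M, v)`. -/
noncomputable def finalState (M : Matrix (Fin n) (Fin n) (ZMod p)) (v : Fin n → ZMod p) :
    State p n A.work :=
  A.steps.foldl (fun ψ s => s.eval M v ψ) (EuclideanSpace.single A.init (1 : ℂ))

end QueryAlgorithm

/-- The orthogonal projection onto the span of the basis states with output register `y`. -/
noncomputable def outputProj [NeZero p] (y : Fin n → ZMod p) (ψ : State p n w) : State p n w :=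
  WithLp.toLp 2 fun b => if b.2.2.1 = y then ψ b else 0

/-- The probability that measuring the output register of `A` on input `(M, v)` in the standard
basis gives `M v`. -/
noncomputable def QueryAlgorithm.successProb [NeZero p] (A : QueryAlgorithm p n)
    (M : Matrix (Fin n) (Fin n) (ZMod p)) (v : Fin n → ZMod p) : ℝ :=
  ‖outputProj (M.mulVec v) (A.finalState M v)‖ ^ 2

end QuantumMvM

/-!
The theorem holds because average-case matrix-vector multiplication over `𝔽_p` already costs
`Ω(n²)` matrix queries, even when the success probability is only `exp(-n/20)` and the vector is
free. The hypotheses therefore force `n² < 20 Q`, and within a budget of `80 Q` queries a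
`d × d` product can be computed exactly, for every matrix and every vector, by reading each entry
(`exactAlgorithm`, which uses `4 d² ≤ 4 n²` queries).

The lower bound (`expect_expect_successProb_le`) is the polynomial method together with a Chernoff
bound. Fix `v`. After `t` matrix queries every amplitude, as a function of `M`, is a combination of
characters `M ↦ e(⟨s, M⟩)` with `s` of Hamming weight at most `t` (`finalState_mem_degreeLE`).
The event `M v = y` is a fibre of a linear map whose dual is `u ↦ u vᵀ`; expanding its indicator
into characters and applying Parseval shows that a function with Fourier support in the Hamming ball
of radius `t` has at most the fraction `max_s Pr_u[|s - u vᵀ| ≤ t]` of its mass on such a fibre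
(`sum_norm_sq_fibre_le`). For random `u` the `n` rows of `s - u vᵀ` are independent, and each has
expected weight at least `|v| / 2`, so this probability is at most `exp(t/n - |v|/4)`
(`card_rankOne_translate_le`). A random `v` has about `(1 - 1/p) n ≥ n / 2` nonzero entries, and the
average over `v` is at most `exp(t/n - n/10)`, which is at most `exp(-n/20)` once `20 t ≤ n²`.
Since `k ≤ n`, this is below the assumed success probability `α ≥ 4 exp(-k/3200)`.
-/

namespace QuantumMvM

/-! ### Fourier analysis on `𝔽_p^ι` -/

section Fourier

open Matrix

variable {p : ℕ} [Fact p.Prime] {ι κ : Type*} [Fintype ι] [Fintype κ]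

/-- Orthogonality of characters on `𝔽_p^ι`. -/
theorem sum_stdAddChar_dotProduct [DecidableEq ι] (x : ι → ZMod p) :
    ∑ s : ι → ZMod p, ZMod.stdAddChar (s ⬝ᵥ x) =
      if x = 0 then (p : ℂ) ^ Fintype.card ι else 0 := by
  have key : ∀ i, ∑ a : ZMod p, (ZMod.stdAddChar (a * x i) : ℂ) = if x i = 0 then (p : ℂ) else 0 := by
    intro i
    have := AddChar.sum_mulShift (x i) (ZMod.isPrimitive_stdAddChar p)
    simpa [ZMod.card] using this
  have h : ∑ s : ι → ZMod p, (ZMod.stdAddChar (s ⬝ᵥ x) : ℂ) =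
      ∏ i, ∑ a : ZMod p, (ZMod.stdAddChar (a * x i) : ℂ) := by
    rw [Finset.prod_univ_sum, Fintype.piFinset_univ]
    refine Finset.sum_congr rfl fun s _ => ?_
    -- An additive character is a monoid homomorphism on `Multiplicative (ZMod p)`.
    exact map_prod (ZMod.stdAddChar (N := p)).toMonoidHom
      (fun i => Multiplicative.ofAdd (s i * x i)) Finset.univ
  rw [h]
  simp only [key]
  split_ifs with hx
  · simp [hx]
  · obtain ⟨i, hi⟩ := Function.ne_iff.mp hx
    exact Finset.prod_eq_zero (Finset.mem_univ i) (if_neg hi)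

theorem star_stdAddChar (a : ZMod p) :
    (starRingEnd ℂ) (ZMod.stdAddChar a) = ZMod.stdAddChar (-a) := by
  rw [AddChar.map_neg_eq_conj]

/-- The (unnormalized) Fourier transform on `𝔽_p^ι`. -/
noncomputable def charTransform [DecidableEq ι] (f : (ι → ZMod p) → ℂ) (s : ι → ZMod p) : ℂ :=
  ∑ x : ι → ZMod p, ZMod.stdAddChar (-(s ⬝ᵥ x)) * f x

variable [DecidableEq ι]

/-- Multiplication by a character translates the Fourier transform. -/
theorem charTransform_char_mul (f : (ι → ZMod p) → ℂ) (r s : ι → ZMod p) :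
    charTransform (fun x => ZMod.stdAddChar (r ⬝ᵥ x) * f x) s = charTransform f (s - r) := by
  refine Finset.sum_congr rfl fun x _ => ?_
  rw [← mul_assoc, ← AddChar.map_add_eq_mul, sub_dotProduct]
  congr 3
  ring

/-- Parseval's identity. -/
theorem sum_charTransform_mul_conj (f g : (ι → ZMod p) → ℂ) :
    ∑ s, charTransform f s * (starRingEnd ℂ) (charTransform g s) =
      (p : ℂ) ^ Fintype.card ι * ∑ x, f x * (starRingEnd ℂ) (g x) := by
  have h : ∀ s, charTransform f s * (starRingEnd ℂ) (charTransform g s) =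
      ∑ x, ∑ y, (f x * (starRingEnd ℂ) (g y)) * ZMod.stdAddChar (s ⬝ᵥ (y - x)) := by
    intro s
    simp only [charTransform, map_sum, Finset.sum_mul_sum, map_mul, star_stdAddChar, neg_neg]
    refine Finset.sum_congr rfl fun x _ => Finset.sum_congr rfl fun y _ => ?_
    rw [dotProduct_sub, sub_eq_neg_add, AddChar.map_add_eq_mul]
    ring
  simp only [h]
  rw [Finset.sum_comm, Finset.mul_sum]
  refine Finset.sum_congr rfl fun x _ => ?_
  rw [Finset.sum_comm]
  simp only [← Finset.mul_sum, sum_stdAddChar_dotProduct, sub_eq_zero]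
  simp [mul_comm]

theorem sum_norm_charTransform_sq (f : (ι → ZMod p) → ℂ) :
    ∑ s, ‖charTransform f s‖ ^ 2 = (p : ℝ) ^ Fintype.card ι * ∑ x, ‖f x‖ ^ 2 := by
  have h := sum_charTransform_mul_conj f f
  simp only [Complex.mul_conj, Complex.normSq_eq_norm_sq] at h
  exact_mod_cast h

/-- The functions on `𝔽_p^ι` of degree at most `t`: those whose Fourier transform is supported on
vectors of Hamming weight at most `t`. -/
noncomputable def degreeLE (p : ℕ) [Fact p.Prime] (ι : Type*) [Fintype ι] [DecidableEq ι] (t : ℕ) :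
    Submodule ℂ ((ι → ZMod p) → ℂ) where
  carrier := {f | ∀ s, t < hammingNorm s → charTransform f s = 0}
  add_mem' {f g} hf hg s hs := by
    have := congrArg₂ (· + ·) (hf s hs) (hg s hs)
    simpa [charTransform, mul_add, Finset.sum_add_distrib] using this
  zero_mem' s _ := by simp [charTransform]
  smul_mem' c f hf s hs := by
    have := congrArg (c * ·) (hf s hs)
    simpa [charTransform, Finset.mul_sum, mul_left_comm] using this

theorem const_mem_degreeLE (c : ℂ) (t : ℕ) : (fun _ => c) ∈ degreeLE p ι t := by
  intro s hs
  have hs0 : -s ≠ 0 := by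
    rw [ne_eq, neg_eq_zero]
    rintro rfl
    simp at hs
  have h := sum_stdAddChar_dotProduct (-s)
  rw [if_neg hs0] at h
  simp only [charTransform, ← Finset.sum_mul]
  simp only [dotProduct_comm _ (-s), neg_dotProduct] at h
  rw [h, zero_mul]

/-- Multiplication by a character of a single coordinate raises the degree by at most one. -/
theorem char_coord_mul_mem_degreeLE {t : ℕ} {f : (ι → ZMod p) → ℂ} (hf : f ∈ degreeLE p ι t)
    (i : ι) (a : ZMod p) :
    (fun x => ZMod.stdAddChar (a * x i) * f x) ∈ degreeLE p ι (t + 1) := by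
  intro s hs
  have h := charTransform_char_mul f (Pi.single i a) s
  simp only [single_dotProduct] at h
  rw [h]
  refine hf _ ?_
  have hsingle : hammingNorm (Pi.single i a : ι → ZMod p) ≤ 1 := by
    refine (Finset.card_le_card (t := {i}) fun j hj => ?_).trans (by simp)
    by_contra hji
    rw [Finset.mem_singleton] at hji
    exact (Finset.mem_filter.mp hj).2 (by simp [hji])
  have htri := hammingDist_triangle s (Pi.single i a) 0
  rw [hammingDist_zero_right, hammingDist_zero_right, hammingDist_comm,
    hammingDist_eq_hammingNorm, neg_add_eq_sub] at htri
  omega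

/-- A choice between functions of degree at most `t` that is governed by one coordinate has degree
at most `t + 1`: this is the effect of one query on the amplitudes. -/
theorem select_mem_degreeLE {t : ℕ} {f : ZMod p → (ι → ZMod p) → ℂ}
    (hf : ∀ c, f c ∈ degreeLE p ι t) (i : ι) :
    (fun x => f (x i) x) ∈ degreeLE p ι (t + 1) := by
  have hp : (p : ℂ) ≠ 0 := Nat.cast_ne_zero.mpr (Fact.out : p.Prime).ne_zero
  have h : (fun x => f (x i) x) = ∑ c : ZMod p, ∑ a : ZMod p,
      ((p : ℂ)⁻¹ * ZMod.stdAddChar (-(a * c))) •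
        (fun x : ι → ZMod p => ZMod.stdAddChar (a * x i) * f c x) := by
    funext x
    simp only [Finset.sum_apply, Pi.smul_apply, smul_eq_mul]
    have hc : ∀ c : ZMod p, ∑ a : ZMod p, (p : ℂ)⁻¹ * ZMod.stdAddChar (-(a * c)) *
        (ZMod.stdAddChar (a * x i) * f c x) = if c = x i then f c x else 0 := by
      intro c
      have := AddChar.sum_mulShift (x i - c) (ZMod.isPrimitive_stdAddChar p)
      have h2 : ∀ a : ZMod p, (p : ℂ)⁻¹ * ZMod.stdAddChar (-(a * c)) *
          (ZMod.stdAddChar (a * x i) * f c x) =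
          (p : ℂ)⁻¹ * f c x * ZMod.stdAddChar (a * (x i - c)) := by
        intro a
        rw [mul_sub, sub_eq_neg_add, AddChar.map_add_eq_mul]
        ring
      simp only [h2, ← Finset.mul_sum, this, sub_eq_zero, ZMod.card, eq_comm (a := c)]
      split_ifs
      · field_simp
      · simp
    simp [hc]
  rw [h]
  exact Submodule.sum_mem _ fun c _ => Submodule.sum_mem _ fun a _ =>
    Submodule.smul_mem _ _ (char_coord_mul_mem_degreeLE (hf c) i a)

/-- Let `g` be the linear map dual to `T`. A function of degree at most `t` can put on a fibre of
`g` at most the fraction of its mass which is the largest density of a Hamming ball of radius `t` in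
a translate of the range of `T`. -/
theorem sum_norm_sq_fibre_le [DecidableEq κ] {t : ℕ} {N : ℝ} {f : (ι → ZMod p) → ℂ}
    (hf : f ∈ degreeLE p ι t) (T : (κ → ZMod p) →ₗ[ZMod p] (ι → ZMod p))
    (g : (ι → ZMod p) → (κ → ZMod p)) (hg : ∀ u x, T u ⬝ᵥ x = u ⬝ᵥ g x)
    (hN : ∀ s, ((Finset.univ.filter fun u => hammingNorm (s - T u) ≤ t).card : ℝ) ≤ N)
    (y : κ → ZMod p) :
    (p : ℝ) ^ Fintype.card κ * ∑ x, (if g x = y then ‖f x‖ ^ 2 else 0) ≤ N * ∑ x, ‖f x‖ ^ 2 := by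
  have hp : (0 : ℝ) < (p : ℝ) ^ Fintype.card ι :=
    pow_pos (Nat.cast_pos.mpr (Fact.out : p.Prime).pos) _
  set a : (ι → ZMod p) → ℝ := fun s => ‖charTransform f s‖ with ha
  -- Expand the indicator of the fibre into characters, and apply Parseval to each of them.
  have hexp : ((((p : ℝ) ^ Fintype.card ι * ((p : ℝ) ^ Fintype.card κ *
      ∑ x, (if g x = y then ‖f x‖ ^ 2 else 0)) : ℝ)) : ℂ) =
      ∑ u : κ → ZMod p, ZMod.stdAddChar (-(u ⬝ᵥ y)) *
        ∑ s, charTransform f (s - T u) * (starRingEnd ℂ) (charTransform f s) := by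
    simp only [← charTransform_char_mul, sum_charTransform_mul_conj, hg]
    push_cast
    simp only [mul_left_comm _ ((p : ℂ) ^ Fintype.card ι), ← Finset.mul_sum]
    congr 1
    simp only [Finset.mul_sum]
    rw [Finset.sum_comm]
    refine Finset.sum_congr rfl fun x _ => ?_
    have h : ∀ u : κ → ZMod p, ZMod.stdAddChar (-(u ⬝ᵥ y)) *
        (ZMod.stdAddChar (u ⬝ᵥ g x) * f x * (starRingEnd ℂ) (f x)) =
        ZMod.stdAddChar (u ⬝ᵥ (g x - y)) * ((‖f x‖ ^ 2 : ℝ) : ℂ) := by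
      intro u
      rw [dotProduct_sub, sub_eq_neg_add, AddChar.map_add_eq_mul, ← Complex.normSq_eq_norm_sq,
        ← Complex.mul_conj]
      ring
    simp only [h, ← Finset.sum_mul, sum_stdAddChar_dotProduct, sub_eq_zero]
    split_ifs <;> simp
  have hle : (p : ℝ) ^ Fintype.card ι * ((p : ℝ) ^ Fintype.card κ *
      ∑ x, (if g x = y then ‖f x‖ ^ 2 else 0)) ≤
      ∑ u : κ → ZMod p, ∑ s, a (s - T u) * a s := by
    have hnn : 0 ≤ (p : ℝ) ^ Fintype.card ι * ((p : ℝ) ^ Fintype.card κ *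
      ∑ x, (if g x = y then ‖f x‖ ^ 2 else 0)) := by
      have : 0 ≤ ∑ x, (if g x = y then ‖f x‖ ^ 2 else 0) :=
        Finset.sum_nonneg fun x _ => by split_ifs <;> positivity
      positivity
    have h := congrArg norm hexp
    rw [Complex.norm_real, Real.norm_of_nonneg hnn] at h
    rw [h]
    refine (norm_sum_le _ _).trans (Finset.sum_le_sum fun u _ => ?_)
    rw [norm_mul, AddChar.norm_apply, one_mul]
    refine (norm_sum_le _ _).trans (Finset.sum_le_sum fun s _ => ?_)
    rw [norm_mul, RCLike.norm_conj]
  -- A product vanishes unless both frequencies lie in the Hamming ball.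
  have hprod : ∀ (u : κ → ZMod p) (s : ι → ZMod p), a (s - T u) * a s ≤
      ((if hammingNorm s ≤ t then a (s - T u) ^ 2 else 0) +
        (if hammingNorm (s - T u) ≤ t then a s ^ 2 else 0)) / 2 := by
    intro u s
    have hz : ∀ r, ¬ hammingNorm r ≤ t → a r = 0 := fun r hr => by
      simp [ha, hf r (not_le.mp hr)]
    split_ifs with h1 h2 h2
    · nlinarith [sq_nonneg (a (s - T u) - a s)]
    · rw [hz _ h2]; simp
    · rw [hz _ h1]; simp
    · rw [hz _ h1]; simp
  have hcount : ∀ s, ∑ u : κ → ZMod p, (if hammingNorm (s - T u) ≤ t then a s ^ 2 else 0) ≤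
      N * a s ^ 2 := by
    intro s
    rw [← Finset.sum_filter, Finset.sum_const, nsmul_eq_mul]
    exact mul_le_mul_of_nonneg_right (hN s) (sq_nonneg _)
  have hsecond : ∑ u : κ → ZMod p, ∑ s, (if hammingNorm (s - T u) ≤ t then a s ^ 2 else 0) ≤
      N * ∑ s, a s ^ 2 := by
    rw [Finset.sum_comm, Finset.mul_sum]
    exact Finset.sum_le_sum fun s _ => hcount s
  -- The translation `s ↦ s + T u` followed by `u ↦ -u` turns the first term into the second.
  have hfirst : ∑ u : κ → ZMod p, ∑ s, (if hammingNorm s ≤ t then a (s - T u) ^ 2 else 0) =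
      ∑ u : κ → ZMod p, ∑ s, (if hammingNorm (s - T u) ≤ t then a s ^ 2 else 0) := by
    rw [← Equiv.sum_comp (Equiv.neg (κ → ZMod p))]
    refine Finset.sum_congr rfl fun u _ => ?_
    rw [← Equiv.sum_comp (Equiv.subRight (T u))]
    simp
  have htotal : (p : ℝ) ^ Fintype.card ι * ((p : ℝ) ^ Fintype.card κ *
      ∑ x, (if g x = y then ‖f x‖ ^ 2 else 0)) ≤
      (p : ℝ) ^ Fintype.card ι * (N * ∑ x, ‖f x‖ ^ 2) := by
    calc _ ≤ _ := hle
      _ ≤ ∑ u : κ → ZMod p, ∑ s, ((if hammingNorm s ≤ t then a (s - T u) ^ 2 else 0) +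
        (if hammingNorm (s - T u) ≤ t then a s ^ 2 else 0)) / 2 :=
          Finset.sum_le_sum fun u _ => Finset.sum_le_sum fun s _ => hprod u s
      _ = ∑ u : κ → ZMod p, ∑ s, (if hammingNorm (s - T u) ≤ t then a s ^ 2 else 0) := by
          simp only [← Finset.sum_div, Finset.sum_add_distrib]
          rw [hfirst]
          ring
      _ ≤ N * ∑ s, a s ^ 2 := hsecond
      _ = _ := by
          rw [ha, sum_norm_charTransform_sq]
          ring
  exact le_of_mul_le_mul_left htotal hp

end Fourier

/-! ### Translates of rank-one matrices of low Hamming weight -/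

section Counting

variable {p : ℕ} [Fact p.Prime]

theorem exp_neg_le_one_sub_half {x : ℝ} (h0 : 0 ≤ x) (h1 : x ≤ 1) :
    Real.exp (-x) ≤ 1 - x / 2 := by
  rw [Real.exp_neg, inv_le_iff_one_le_mul₀ (Real.exp_pos x)]
  nlinarith [Real.add_one_le_exp x]

theorem sum_hammingNorm_sub_mul_ge {n : ℕ} (r v : Fin n → ZMod p) :
    (hammingNorm v : ℝ) * (p / 2) ≤
      ∑ a : ZMod p, (hammingNorm (fun k => r k - a * v k) : ℝ) := by
  have hp : (2 : ℝ) ≤ p := by exact_mod_cast (Fact.out : p.Prime).two_le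
  have hn : ∀ w : Fin n → ZMod p, (hammingNorm w : ℝ) = ∑ k, if w k ≠ 0 then (1 : ℝ) else 0 := by
    intro w
    rw [hammingNorm, Finset.card_filter, Nat.cast_sum]
    exact Finset.sum_congr rfl fun k _ => by split_ifs <;> simp
  simp only [hn]
  rw [Finset.sum_comm, Finset.sum_mul]
  refine Finset.sum_le_sum fun k _ => ?_
  by_cases hk : v k = 0
  · simp only [hk, ne_eq, not_true_eq_false, if_false, zero_mul]
    exact Finset.sum_nonneg fun a _ => by split_ifs <;> norm_num
  · have h : ∀ a : ZMod p, (if r k - a * v k ≠ 0 then (1 : ℝ) else 0) =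
        1 - if a = r k / v k then 1 else 0 := by
      intro a
      have hiff : a = r k / v k ↔ r k - a * v k = 0 := by
        rw [eq_div_iff hk, sub_eq_zero, eq_comm]
      simp only [hiff]
      split_ifs <;> simp_all
    simp only [h, Finset.sum_sub_distrib]
    simp [hk, ZMod.card]
    linarith

theorem sum_exp_neg_hammingNorm_row_le {n : ℕ} (hn : 0 < n) (r v : Fin n → ZMod p) :
    ∑ a : ZMod p, Real.exp (-((hammingNorm fun k => r k - a * v k) / n : ℝ)) ≤
      p * Real.exp (-(hammingNorm v / (4 * n) : ℝ)) := by
  have hn' : (0 : ℝ) < n := Nat.cast_pos.mpr hn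
  have hpos : (0 : ℝ) ≤ p := Nat.cast_nonneg p
  have h1 : ∀ a : ZMod p, Real.exp (-((hammingNorm fun k => r k - a * v k) / n : ℝ)) ≤
      1 - ((hammingNorm fun k => r k - a * v k) / n : ℝ) / 2 := by
    intro a
    refine exp_neg_le_one_sub_half (by positivity) ?_
    rw [div_le_one hn']
    have := hammingNorm_le_card_fintype (x := fun k => r k - a * v k)
    rw [Fintype.card_fin] at this
    exact_mod_cast this
  have h2 := sum_hammingNorm_sub_mul_ge r v
  have h3 := Real.add_one_le_exp (-(hammingNorm v / (4 * n) : ℝ))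
  calc _ ≤ ∑ a : ZMod p, (1 - ((hammingNorm fun k => r k - a * v k) / n : ℝ) / 2) :=
        Finset.sum_le_sum fun a _ => h1 a
    _ = p - (∑ a : ZMod p, (hammingNorm (fun k => r k - a * v k) : ℝ)) / n / 2 := by
        simp [Finset.sum_sub_distrib, ← Finset.sum_div, ZMod.card]
    _ ≤ p - (hammingNorm v : ℝ) * (p / 2) / n / 2 := by gcongr
    _ = p * (-(hammingNorm v / (4 * n) : ℝ) + 1) := by field_simp; ring
    _ ≤ _ := by gcongr

/-- `u ↦ u vᵀ`, as a linear map into the functions on pairs of indices. -/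
def rankOne {n : ℕ} (v : Fin n → ZMod p) :
    (Fin n → ZMod p) →ₗ[ZMod p] (Fin n × Fin n → ZMod p) where
  toFun u i := u i.1 * v i.2
  map_add' u u' := by
    funext i
    simp [add_mul]
  map_smul' c u := by
    funext i
    simp [mul_assoc]

theorem hammingNorm_eq_sum_rows {n : ℕ} (s : Fin n × Fin n → ZMod p) :
    hammingNorm s = ∑ j, hammingNorm fun k => s (j, k) := by
  simp only [hammingNorm, Finset.card_filter]
  exact Fintype.sum_prod_type _

/-- A Chernoff bound: under a uniformly random `u` the rows of `s - u vᵀ` are independent, and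
each has expected weight at least half the weight of `v`. -/
theorem card_rankOne_translate_le {n : ℕ} (hn : 0 < n) (v : Fin n → ZMod p) (t : ℕ)
    (s : Fin n × Fin n → ZMod p) :
    ((Finset.univ.filter fun u => hammingNorm (s - rankOne v u) ≤ t).card : ℝ) ≤
      (p : ℝ) ^ n * (Real.exp (t / n) * Real.exp (-(hammingNorm v / 4 : ℝ))) := by
  have hn' : (0 : ℝ) < n := Nat.cast_pos.mpr hn
  have h1 : ∀ u : Fin n → ZMod p, (if hammingNorm (s - rankOne v u) ≤ t then (1 : ℝ) else 0) ≤
      Real.exp (t / n) *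
        ∏ j, Real.exp (-((hammingNorm fun k => s (j, k) - u j * v k) / n : ℝ)) := by
    intro u
    rw [← Real.exp_sum, ← Real.exp_add]
    split_ifs with h
    · rw [Real.one_le_exp_iff, Finset.sum_neg_distrib, ← Finset.sum_div, ← sub_eq_add_neg,
        ← sub_div]
      refine div_nonneg ?_ hn'.le
      rw [sub_nonneg]
      rw [hammingNorm_eq_sum_rows] at h
      exact_mod_cast h
    · positivity
  calc ((Finset.univ.filter fun u => hammingNorm (s - rankOne v u) ≤ t).card : ℝ)
      = ∑ u : Fin n → ZMod p, if hammingNorm (s - rankOne v u) ≤ t then (1 : ℝ) else 0 := by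
        simp
    _ ≤ ∑ u : Fin n → ZMod p, Real.exp (t / n) *
        ∏ j, Real.exp (-((hammingNorm fun k => s (j, k) - u j * v k) / n : ℝ)) :=
        Finset.sum_le_sum fun u _ => h1 u
    _ = Real.exp (t / n) * ∏ j, ∑ a : ZMod p,
        Real.exp (-((hammingNorm fun k => s (j, k) - a * v k) / n : ℝ)) := by
        rw [Finset.prod_univ_sum, Fintype.piFinset_univ, Finset.mul_sum]
    _ ≤ Real.exp (t / n) * ∏ _j : Fin n, (p * Real.exp (-(hammingNorm v / (4 * n) : ℝ))) := by
        gcongr with j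
        exact sum_exp_neg_hammingNorm_row_le hn (fun k => s (j, k)) v
    _ = _ := by
        rw [Finset.prod_const, Finset.card_univ, Fintype.card_fin, mul_pow, ← Real.exp_nat_mul]
        have : (n : ℝ) * -(hammingNorm v / (4 * n)) = -(hammingNorm v / 4) := by field_simp
        rw [this]
        ring

theorem sum_exp_neg_hammingNorm_le (n : ℕ) :
    ∑ v : Fin n → ZMod p, Real.exp (-(hammingNorm v / 4 : ℝ)) ≤
      (p : ℝ) ^ n * Real.exp (-(n / 10 : ℝ)) := by
  have hp : (2 : ℝ) ≤ p := by exact_mod_cast (Fact.out : p.Prime).two_le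
  have hexp : Real.exp (-(1 / 4 : ℝ)) ≤ 4 / 5 := by
    rw [Real.exp_neg, inv_le_comm₀ (Real.exp_pos _) (by norm_num)]
    linarith [Real.add_one_le_exp (1 / 4 : ℝ)]
  have h1 : ∀ v : Fin n → ZMod p, Real.exp (-(hammingNorm v / 4 : ℝ)) =
      ∏ k, if v k = 0 then 1 else Real.exp (-(1 / 4 : ℝ)) := by
    intro v
    rw [Finset.prod_ite]
    simp only [Finset.prod_const_one, one_mul, Finset.prod_const, hammingNorm]
    rw [← Real.exp_nat_mul]
    congr 1
    ring
  have h2 : ∑ a : ZMod p, (if a = 0 then 1 else Real.exp (-(1 / 4 : ℝ))) ≤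
      p * Real.exp (-(1 / 10 : ℝ)) := by
    have h : ∀ a : ZMod p, (if a = 0 then 1 else Real.exp (-(1 / 4 : ℝ))) =
        Real.exp (-(1 / 4 : ℝ)) + if a = 0 then 1 - Real.exp (-(1 / 4 : ℝ)) else 0 := by
      intro a
      split_ifs <;> ring
    simp only [h, Finset.sum_add_distrib]
    simp only [Finset.sum_const, Finset.card_univ, ZMod.card, nsmul_eq_mul, Finset.sum_ite_eq',
      Finset.mem_univ, if_true]
    have := Real.add_one_le_exp (-(1 / 10 : ℝ))
    nlinarith
  calc _ = ∏ _k : Fin n, ∑ a : ZMod p, (if a = 0 then 1 else Real.exp (-(1 / 4 : ℝ))) := by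
        rw [Finset.prod_univ_sum, Fintype.piFinset_univ]
        exact Finset.sum_congr rfl fun v _ => h1 v
    _ ≤ ∏ _k : Fin n, (p * Real.exp (-(1 / 10 : ℝ))) := by
        gcongr with k
    _ = _ := by
        rw [Finset.prod_const, Finset.card_univ, Fintype.card_fin, mul_pow, ← Real.exp_nat_mul]
        congr 2
        ring

end Counting

/-! ### The average success probability of an algorithm with few matrix queries -/

section LowerBound

open Matrix

variable {p : ℕ} [Fact p.Prime] {n w : ℕ}

theorem permUnitary_apply (e : Equiv.Perm (Basis p n w)) (ψ : State p n w) (b : Basis p n w) :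
    permUnitary e ψ b = ψ (e.symm b) := rfl

theorem permUnitary_symm (e : Equiv.Perm (Basis p n w)) :
    (permUnitary e).symm = permUnitary e.symm :=
  LinearIsometryEquiv.piLpCongrLeft_symm e

/-- The matrix whose entries are listed by a function on pairs of indices. -/
def toMatrix (x : Fin n × Fin n → ZMod p) : Matrix (Fin n) (Fin n) (ZMod p) :=
  Matrix.of fun j k => x (j, k)

theorem unitary_apply_mem_degreeLE {t : ℕ} (U : State p n w ≃ₗᵢ[ℂ] State p n w)
    {ψ : (Fin n × Fin n → ZMod p) → State p n w}
    (hψ : ∀ b, (fun x => ψ x b) ∈ degreeLE p (Fin n × Fin n) t) (b : Basis p n w) :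
    (fun x => U (ψ x) b) ∈ degreeLE p (Fin n × Fin n) t := by
  have h : (fun x => U (ψ x) b) =
      ∑ c : Basis p n w, (U (EuclideanSpace.single c (1 : ℂ)) b) • fun x => ψ x c := by
    funext x
    have hx : ψ x = ∑ c : Basis p n w, ψ x c • EuclideanSpace.single c (1 : ℂ) := by
      ext c
      simp [Pi.single_apply]
    conv_lhs => rw [hx]
    simp [Finset.sum_apply, mul_comm]
  rw [h]
  exact Submodule.sum_mem _ fun c _ => Submodule.smul_mem _ _ (hψ c)

theorem step_apply_mem_degreeLE {t : ℕ} (v : Fin n → ZMod p) (st : Step p n w)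
    {ψ : (Fin n × Fin n → ZMod p) → State p n w}
    (hψ : ∀ b, (fun x => ψ x b) ∈ degreeLE p (Fin n × Fin n) t) (b : Basis p n w) :
    (fun x => st.eval (toMatrix x) v (ψ x) b) ∈
      degreeLE p (Fin n × Fin n) (t + st.matrixCost) := by
  cases st with
  | unitary U => exact unitary_apply_mem_degreeLE U hψ b
  | matrixQuery =>
    exact select_mem_degreeLE
      (fun c => hψ ((b.1.1, b.1.2.1, b.1.2.2 - c), b.2)) (b.1.1, b.1.2.1)
  | matrixQueryInv =>
    change (fun x => (permUnitary (matrixPerm (toMatrix x))).symm (ψ x) b) ∈ _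
    simp only [permUnitary_symm]
    exact select_mem_degreeLE
      (fun c => hψ ((b.1.1, b.1.2.1, b.1.2.2 + c), b.2)) (b.1.1, b.1.2.1)
  | vectorQuery => exact unitary_apply_mem_degreeLE (vectorOracle v) hψ b
  | vectorQueryInv => exact unitary_apply_mem_degreeLE (vectorOracle v).symm hψ b

theorem foldl_steps_mem_degreeLE (v : Fin n → ZMod p) (L : List (Step p n w)) :
    ∀ {t : ℕ} {ψ : (Fin n × Fin n → ZMod p) → State p n w},
    (∀ b, (fun x => ψ x b) ∈ degreeLE p (Fin n × Fin n) t) → ∀ b,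
    (fun x => L.foldl (fun ψ s => s.eval (toMatrix x) v ψ) (ψ x) b) ∈
      degreeLE p (Fin n × Fin n) (t + (L.map Step.matrixCost).sum) := by
  induction L with
  | nil => exact fun hψ b => hψ b
  | cons st L ih =>
    intro t ψ hψ b
    rw [List.map_cons, List.sum_cons, ← add_assoc]
    exact ih (ψ := fun x => st.eval (toMatrix x) v (ψ x)) (step_apply_mem_degreeLE v st hψ) b

/-- The polynomial method: as functions of the matrix, the final amplitudes have degree at most the
number of matrix queries. -/
theorem finalState_mem_degreeLE (A : QueryAlgorithm p n) (v : Fin n → ZMod p)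
    (b : Basis p n A.work) :
    (fun x => A.finalState (toMatrix x) v b) ∈ degreeLE p (Fin n × Fin n) A.matrixQueries := by
  have h := foldl_steps_mem_degreeLE (t := 0) v A.steps
    (ψ := fun _ => EuclideanSpace.single A.init (1 : ℂ)) (fun b => const_mem_degreeLE _ 0) b
  rwa [zero_add] at h

theorem norm_finalState (A : QueryAlgorithm p n) (M : Matrix (Fin n) (Fin n) (ZMod p))
    (v : Fin n → ZMod p) : ‖A.finalState M v‖ = 1 := by
  have h : ∀ (L : List (Step p n A.work)) (ψ : State p n A.work),
      ‖L.foldl (fun ψ s => s.eval M v ψ) ψ‖ = ‖ψ‖ := by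
    intro L
    induction L with
    | nil => exact fun _ => rfl
    | cons st L ih =>
      intro ψ
      rw [List.foldl_cons, ih, LinearIsometryEquiv.norm_map]
  rw [QueryAlgorithm.finalState, h]
  simp

theorem successProb_eq_sum (A : QueryAlgorithm p n) (M : Matrix (Fin n) (Fin n) (ZMod p))
    (v : Fin n → ZMod p) :
    A.successProb M v =
      ∑ b, if M.mulVec v = b.2.2.1 then ‖A.finalState M v b‖ ^ 2 else 0 := by
  rw [QueryAlgorithm.successProb, EuclideanSpace.norm_sq_eq]
  refine Finset.sum_congr rfl fun b _ => ?_
  simp only [outputProj, eq_comm (a := M.mulVec v)]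
  split_ifs <;> simp

theorem rankOne_dotProduct (u v : Fin n → ZMod p) (x : Fin n × Fin n → ZMod p) :
    rankOne v u ⬝ᵥ x = u ⬝ᵥ (toMatrix x).mulVec v := by
  simp only [dotProduct, rankOne, LinearMap.coe_mk, AddHom.coe_mk, Fintype.sum_prod_type,
    Matrix.mulVec, toMatrix, Matrix.of_apply, Finset.mul_sum]
  exact Finset.sum_congr rfl fun j _ => Finset.sum_congr rfl fun k _ => by ring

theorem expect_matrix_eq (F : Matrix (Fin n) (Fin n) (ZMod p) → ℝ) :
    𝔼 M, F M = 𝔼 x : Fin n × Fin n → ZMod p, F (toMatrix x) :=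
  (Fintype.expect_equiv ((Equiv.curry _ _ _).trans Matrix.of) _ _ fun _ => rfl).symm

/-- For a fixed vector, the success probability averaged over the matrices. -/
theorem expect_successProb_le (hn : 0 < n) (A : QueryAlgorithm p n) (v : Fin n → ZMod p) :
    𝔼 M, A.successProb M v ≤
      Real.exp (A.matrixQueries / n) * Real.exp (-(hammingNorm v / 4 : ℝ)) := by
  have hp : (0 : ℝ) < p := Nat.cast_pos.mpr (Fact.out : p.Prime).pos
  set B : ℝ := Real.exp (A.matrixQueries / n) * Real.exp (-(hammingNorm v / 4 : ℝ)) with hB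
  have hb : ∀ b : Basis p n A.work, ∑ x, (if (toMatrix x).mulVec v = b.2.2.1 then
      ‖A.finalState (toMatrix x) v b‖ ^ 2 else 0) ≤
      B * ∑ x, ‖A.finalState (toMatrix x) v b‖ ^ 2 := by
    intro b
    have h := sum_norm_sq_fibre_le (finalState_mem_degreeLE A v b) (rankOne v)
      (fun x => (toMatrix x).mulVec v) (fun u x => rankOne_dotProduct u v x)
      (fun s => card_rankOne_translate_le hn v A.matrixQueries s) b.2.2.1
    rw [Fintype.card_fin, mul_assoc] at h
    exact le_of_mul_le_mul_left h (pow_pos hp n)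
  rw [expect_matrix_eq, Fintype.expect_eq_sum_div_card, div_le_iff₀ (by positivity)]
  calc _ = ∑ b : Basis p n A.work, ∑ x, (if (toMatrix x).mulVec v = b.2.2.1 then
        ‖A.finalState (toMatrix x) v b‖ ^ 2 else 0) := by
        simp only [successProb_eq_sum]
        exact Finset.sum_comm
    _ ≤ ∑ b : Basis p n A.work, B * ∑ x, ‖A.finalState (toMatrix x) v b‖ ^ 2 :=
        Finset.sum_le_sum fun b _ => hb b
    _ = B * ∑ x, ‖A.finalState (toMatrix x) v‖ ^ 2 := by
        simp only [EuclideanSpace.norm_sq_eq]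
        rw [← Finset.mul_sum, Finset.sum_comm]
    _ = _ := by simp [norm_finalState]

/-- The lower bound for average-case matrix-vector multiplication: with at most `n² / 20` matrix
queries the average success probability is exponentially small in `n`. -/
theorem expect_expect_successProb_le (hn : 0 < n) (A : QueryAlgorithm p n)
    (hA : 20 * A.matrixQueries ≤ n ^ 2) :
    (𝔼 M : Matrix (Fin n) (Fin n) (ZMod p), 𝔼 v : Fin n → ZMod p, A.successProb M v) ≤
      Real.exp (-(n / 20 : ℝ)) := by
  have hn' : (0 : ℝ) < n := Nat.cast_pos.mpr hn
  have hp : (0 : ℝ) < p := Nat.cast_pos.mpr (Fact.out : p.Prime).pos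
  rw [Finset.expect_comm]
  calc _ ≤ 𝔼 v : Fin n → ZMod p,
        Real.exp (A.matrixQueries / n) * Real.exp (-(hammingNorm v / 4 : ℝ)) :=
        Finset.expect_le_expect fun v _ => expect_successProb_le hn A v
    _ = Real.exp (A.matrixQueries / n) *
        ((∑ v : Fin n → ZMod p, Real.exp (-(hammingNorm v / 4 : ℝ))) / (p : ℝ) ^ n) := by
        rw [← Finset.mul_expect, Fintype.expect_eq_sum_div_card]
        simp [ZMod.card]
    _ ≤ Real.exp (n / 20) * Real.exp (-(n / 10 : ℝ)) := by
        have hA' : (20 : ℝ) * A.matrixQueries ≤ n ^ 2 := by exact_mod_cast hA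
        gcongr ?_ * ?_
        · rw [Real.exp_le_exp, div_le_div_iff₀ hn' (by norm_num)]
          nlinarith
        · rw [div_le_iff₀ (pow_pos hp n), mul_comm]
          exact sum_exp_neg_hammingNorm_le n
    _ = _ := by
        rw [← Real.exp_add]
        congr 1
        ring

end LowerBound

/-! ### An exact algorithm that reads the whole input -/

section Exact

variable {p : ℕ} [Fact p.Prime] {d : ℕ}

/-- Exchange the values `i` and `j`, and `i` and `k`, of the index registers. Applied to registers
with all indices equal to `i` it addresses the entry `(j, k)` of the matrix and the entry `k` of
the vector. -/
def addressPerm (i j k : Fin d) : Equiv.Perm (Basis p d 1) where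
  toFun b := ((Equiv.swap i j b.1.1, Equiv.swap i k b.1.2.1, b.1.2.2),
    (Equiv.swap i k b.2.1.1, b.2.1.2), b.2.2)
  invFun b := ((Equiv.swap i j b.1.1, Equiv.swap i k b.1.2.1, b.1.2.2),
    (Equiv.swap i k b.2.1.1, b.2.1.2), b.2.2)
  left_inv b := by simp
  right_inv b := by simp

/-- Add the product of the two query answers to the entry of the output register that the matrix
query register addresses. -/
def accumulatePerm : Equiv.Perm (Basis p d 1) where
  toFun b := (b.1, b.2.1, b.2.2.1 + Pi.single b.1.1 (b.1.2.2 * b.2.1.2), b.2.2.2)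
  invFun b := (b.1, b.2.1, b.2.2.1 - Pi.single b.1.1 (b.1.2.2 * b.2.1.2), b.2.2.2)
  left_inv b := by simp
  right_inv b := by simp

/-- Add `M j k * v k` to entry `j` of the output register, leaving the other registers as they
were: address, query, accumulate, and undo the queries and the addressing. -/
noncomputable def entrySteps (i j k : Fin d) : List (Step p d 1) :=
  [.unitary (permUnitary (addressPerm i j k)), .matrixQuery, .vectorQuery,
    .unitary (permUnitary accumulatePerm), .vectorQueryInv, .matrixQueryInv,
    .unitary (permUnitary (addressPerm i j k))]

/-- The algorithm that runs through all the entries of the matrix. -/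
noncomputable def exactAlgorithm (p : ℕ) [Fact p.Prime] {d : ℕ} (i : Fin d) :
    QueryAlgorithm p d where
  work := 1
  init := ((i, i, 0), (i, 0), 0, 0)
  steps := (Finset.univ : Finset (Fin d × Fin d)).toList.flatMap fun e => entrySteps i e.1 e.2

theorem permUnitary_single {n w : ℕ} (e : Equiv.Perm (Basis p n w)) (b : Basis p n w) :
    permUnitary e (EuclideanSpace.single b (1 : ℂ)) = EuclideanSpace.single (e b) 1 := by
  ext c
  rw [permUnitary_apply, PiLp.single_apply, PiLp.single_apply]
  simp only [Equiv.symm_apply_eq]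

theorem foldl_entrySteps (M : Matrix (Fin d) (Fin d) (ZMod p)) (v : Fin d → ZMod p)
    (i j k : Fin d) (y : Fin d → ZMod p) :
    (entrySteps i j k).foldl (fun ψ s => s.eval M v ψ)
      (EuclideanSpace.single (((i, i, 0), (i, 0), y, 0) : Basis p d 1) (1 : ℂ)) =
    EuclideanSpace.single
      (((i, i, 0), (i, 0), y + Pi.single j (M j k * v k), 0) : Basis p d 1) 1 := by
  simp only [entrySteps, List.foldl_cons, List.foldl_nil, Step.eval, matrixOracle, vectorOracle,
    permUnitary_symm, permUnitary_single]
  congr 1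
  simp [addressPerm, accumulatePerm, matrixPerm, vectorPerm, Equiv.symm]

theorem exactAlgorithm_finalState (M : Matrix (Fin d) (Fin d) (ZMod p)) (v : Fin d → ZMod p)
    (i : Fin d) :
    (exactAlgorithm p i).finalState M v =
      EuclideanSpace.single (((i, i, 0), (i, 0), M.mulVec v, 0) : Basis p d 1) 1 := by
  have h : ∀ (L : List (Fin d × Fin d)) (y : Fin d → ZMod p),
      (L.flatMap fun e => entrySteps i e.1 e.2).foldl (fun ψ s => s.eval M v ψ)
        (EuclideanSpace.single (((i, i, 0), (i, 0), y, 0) : Basis p d 1) (1 : ℂ)) =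
      EuclideanSpace.single (((i, i, 0), (i, 0),
        y + (L.map fun e => Pi.single e.1 (M e.1 e.2 * v e.2)).sum, 0) : Basis p d 1) 1 := by
    intro L
    induction L with
    | nil => simp
    | cons e L ih =>
      intro y
      rw [List.flatMap_cons, List.foldl_append, foldl_entrySteps, ih, List.map_cons,
        List.sum_cons, add_assoc]
  have hsum : ∑ e : Fin d × Fin d, (Pi.single e.1 (M e.1 e.2 * v e.2) : Fin d → ZMod p) =
      M.mulVec v := by
    funext j
    rw [Finset.sum_apply, Fintype.sum_prod_type, Finset.sum_eq_single j]
    · simp [Matrix.mulVec, dotProduct]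
    · intro i _ hij
      simp [Pi.single_eq_of_ne hij.symm]
    · simp
  have h2 := h Finset.univ.toList 0
  rw [zero_add, Finset.sum_map_toList, hsum] at h2
  exact h2

theorem exactAlgorithm_successProb (M : Matrix (Fin d) (Fin d) (ZMod p)) (v : Fin d → ZMod p)
    (i : Fin d) : (exactAlgorithm p i).successProb M v = 1 := by
  have hz : ∀ b : Basis p d 1, M.mulVec v ≠ b.2.2.1 → (EuclideanSpace.single
      (((i, i, 0), (i, 0), M.mulVec v, 0) : Basis p d 1) (1 : ℂ) : State p d 1) b = 0 := by
    intro b hb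
    rw [PiLp.single_apply, if_neg]
    rintro rfl
    exact hb rfl
  rw [successProb_eq_sum, ← one_pow 2, ← norm_finalState (exactAlgorithm p i) M v,
    EuclideanSpace.norm_sq_eq]
  refine Finset.sum_congr rfl fun b _ => ?_
  rw [exactAlgorithm_finalState]
  split_ifs with h
  · rfl
  · exact (by simp [hz b h] : (0 : ℝ) = ‖(EuclideanSpace.single
      (((i, i, 0), (i, 0), M.mulVec v, 0) : Basis p d 1) (1 : ℂ) : State p d 1) b‖ ^ 2)

theorem exactAlgorithm_queries (i : Fin d) :
    (exactAlgorithm p i).matrixQueries + (exactAlgorithm p i).vectorQueries = 4 * d ^ 2 := by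
  have h : ∀ L : List (Fin d × Fin d),
      ((L.flatMap fun e => entrySteps (p := p) i e.1 e.2).map Step.matrixCost).sum +
      ((L.flatMap fun e => entrySteps (p := p) i e.1 e.2).map Step.vectorCost).sum =
        4 * L.length := by
    intro L
    induction L with
    | nil => rfl
    | cons e L ih =>
      simp only [List.flatMap_cons, List.map_append, List.sum_append, List.length_cons]
      have h1 : ((entrySteps (p := p) i e.1 e.2).map Step.matrixCost).sum = 2 := rfl
      have h2 : ((entrySteps (p := p) i e.1 e.2).map Step.vectorCost).sum = 2 := rfl
      omega
  have h2 := h Finset.univ.toList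
  rw [Finset.length_toList, Finset.card_univ, Fintype.card_prod, Fintype.card_fin, ← sq] at h2
  exact h2

end Exact

end QuantumMvM

theorem mainTheorem4 :
    ∃ C : ℝ, 0 < C ∧
      ∀ (p : ℕ) [Fact p.Prime] (n k d : ℕ) (α : ℝ) (Q : ℕ)
        (A : QuantumMvM.QueryAlgorithm p n),
        0 < n → n = k * d →
        0 < α → α ≤ 1 → 4 * Real.exp (-(k : ℝ) / 3200) ≤ α →
        A.matrixQueries ≤ Q →
        α ≤ (𝔼 M : Matrix (Fin n) (Fin n) (ZMod p), 𝔼 v : Fin n → ZMod p, A.successProb M v) →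
        ∃ A₃ : QuantumMvM.QueryAlgorithm p d,
          ((A₃.matrixQueries + A₃.vectorQueries : ℕ) : ℝ) ≤
              C * (α⁻¹ ^ 2 * ((Q : ℝ) + (n : ℝ) ^ (3 / 2 : ℝ))) ∧
          ∀ M : Matrix (Fin d) (Fin d) (ZMod p),
            (99 / 100 : ℝ) ≤
              (Nat.card {v : Fin d → ZMod p // (99 / 100 : ℝ) ≤ A₃.successProb M v} : ℝ) /
                Nat.card (Fin d → ZMod p) := by
  refine ⟨80, by norm_num, ?_⟩
  intro p _ n k d α Q A hn hkd hα hα1 hk hQ hsucc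
  have hd : 0 < d := Nat.pos_of_ne_zero fun h => by simp [h] at hkd; omega
  have hk0 : 0 < k := Nat.pos_of_ne_zero fun h => by simp [h] at hkd; omega
  have hkn : k ≤ n := hkd ▸ Nat.le_mul_of_pos_right k hd
  have hdn : d ≤ n := hkd ▸ Nat.le_mul_of_pos_left d hk0
  have hnQ : n ^ 2 < 20 * Q := by
    by_contra! h
    have h1 := hk.trans
      (hsucc.trans (QuantumMvM.expect_expect_successProb_le hn A (by omega)))
    have hkn' : (k : ℝ) ≤ n := Nat.cast_le.mpr hkn
    have h2 : Real.exp (-(n / 20 : ℝ)) ≤ Real.exp (-(k : ℝ) / 3200) := by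
      rw [Real.exp_le_exp]
      have : (0 : ℝ) ≤ k := Nat.cast_nonneg k
      linarith
    linarith [Real.exp_pos (-(k : ℝ) / 3200)]
  refine ⟨QuantumMvM.exactAlgorithm p ⟨0, hd⟩, ?_, fun M => ?_⟩
  · rw [QuantumMvM.exactAlgorithm_queries]
    have h1 : ((4 * d ^ 2 : ℕ) : ℝ) ≤ 80 * Q := by
      have : d ^ 2 ≤ n ^ 2 := Nat.pow_le_pow_left hdn 2
      have : 4 * d ^ 2 ≤ 80 * Q := by omega
      exact_mod_cast this
    have h2 : (1 : ℝ) ≤ α⁻¹ ^ 2 := one_le_pow₀ ((one_le_inv₀ hα).mpr hα1)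
    have h3 : (0 : ℝ) ≤ (n : ℝ) ^ (3 / 2 : ℝ) := by positivity
    have hQ0 : (0 : ℝ) ≤ Q := Nat.cast_nonneg Q
    nlinarith
  · have h : ∀ v, (99 / 100 : ℝ) ≤ (QuantumMvM.exactAlgorithm p ⟨0, hd⟩).successProb M v := by
      intro v
      rw [QuantumMvM.exactAlgorithm_successProb]
      norm_num
    have hcard : Nat.card {v : Fin d → ZMod p // (99 / 100 : ℝ) ≤
        (QuantumMvM.exactAlgorithm p ⟨0, hd⟩).successProb M v} = Nat.card (Fin d → ZMod p) :=
      Nat.card_congr (Equiv.subtypeUnivEquiv h)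
    have hpos : (Nat.card (Fin d → ZMod p) : ℝ) ≠ 0 := Nat.cast_ne_zero.mpr Nat.card_pos.ne'
    rw [hcard, div_self hpos]
    norm_num
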